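/- Let $b\ge 1$ and $\mathbb H=\{0,1\}^b$. Expressions are $\lambda$-terms over string names, $e ::= x \mid \lambda x.\,e \mid e_1\,e_2$, and $|e|$ is the number of nodes of $e$. The randomised hashing algorithm uses the following hash functions and combiners into $\mathbb H$: a hash $f_{\mathrm{name}}(x)$ of names; combiners $f_{\mathrm{SVar}}$, $f_{\mathrm{SLam}}(n,p,s)$, $f_{\mathrm{SApp}}(n,\beta,s_1,s_2)$ for structures; combiners $f_{\mathrm{Here}}$, $f_{\mathrm{Join}}(n,t,p_1,p_2)$ for position trees; $f_{\mathrm{entry}}(h,p)$ for entries of variable maps; and a top-level combiner $f_{\mathrm{sum}}(s,m)$. The arguments other than the name $x$ and the flag $\beta\in\{\mathrm{true},\mathrm{false}\}$ lie in $\mathbb H$, except that $p$ in $f_{\mathrm{SLam}}$ and $p_1$ in $f_{\mathrm{Join}}$ may also be $\bot$ ("absent"). Integers are passed modulo $2^b$. The argument $n$ is the size (number of constructor calls) of the object being built; structures and position trees are represented by their hash code together with their size. $\mathtt{summariseExpr}(e)$ is a pair of a structure and a map $V$ from the free variables of $e$ to position trees. $V$ is stored with a hash code, the XOR of $f_{\mathrm{entry}}(f_{\mathrm{name}}(x),\mathrm{hash}(V(x)))$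 over the entries, which is updated at every operation on the map. * A variable $x$ has structure $f_{\mathrm{SVar}}$ and map $\{x\mapsto f_{\mathrm{Here}}\}$, both of size $1$. * For $\lambda x.\,e$, the entry $p$ of $x$ (or $\bot$ if there is none) is removed from the map of $e$, and the structure is $f_{\mathrm{SLam}}(n,p,s)$ where $s$ is the structure of $e$. * For $e_1\,e_2$, the structure is $f_{\mathrm{SApp}}(n,\beta,s_1,s_2)$, where $\beta$ records whether the map of $e_1$ has more entries than that of $e_2$. If $\beta$ is true, the bigger map is that of $e_1$ and the smaller that of $e_2$; otherwise it is the other way round. The new map is obtained from the bigger map by adding every entry $(x,p)$ of the smaller map to it as $x\mapsto f_{\mathrm{Join}}(n',t,p',p)$, where $p'$ is the value (or $\bot$) of $x$ in the bigger map, $n'$ is the size of the new position tree, and the tag $t$ is the size of the new structure. The hash code of $e$ is $f_{\mathrm{sum}}$ of the hash codes of its structure and of its map. The algorithm puts two subexpressions (nodes) of an expression in the same class if and only if their hash codes are equal. **Theorem.** There is a probability distribution on the choices of all these hash functions and combiners, namely one under which they are random (every value at every argument is uniform on $\mathbb H$, and all these values are independent), such that for every expression $e$, with probability at least $$1-5\,|e|^3\cdot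 2^{-b},$$ the set of classes of subexpressions of $e$ produced by the algorithm is exactly the set of $\alpha$-equivalence classes of the subexpressions of $e$. -/

import Mathlib

open MeasureTheory ProbabilityTheory

namespace AlphaHash

/-! ### Expressions, subexpressions and alpha-equivalence -/

/-- Variable names. -/
abbrev Name := String

/-- Expressions of the lambda calculus with named variables. -/
inductive Expression : Type
  | var (x : Name)
  | lam (x : Name) (body : Expression)
  | app (fn arg : Expression)

namespace Expression

/-- The number of nodes of an expression. -/
def size : Expression → ℕ
  | var _ => 1
  | lam _ a => a.size + 1
  | app a c => a.size + c.size + 1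

/-- All subexpressions of an expression, one list entry for every node (in preorder). -/
def subexprs : Expression → List Expression
  | var x => [var x]
  | lam x a => lam x a :: a.subexprs
  | app a c => app a c :: (a.subexprs ++ c.subexprs)

/-- The occurrences of subexpressions (that is, the nodes) of `e`. -/
abbrev Node (e : Expression) : Type := Fin e.subexprs.length

/-- The subexpression rooted at a node. -/
def at_ (e : Expression) (i : e.Node) : Expression := e.subexprs.get i

/-- `AlphaVar ρ x y`: the variable `x` on the left and the variable `y` on the right have the same
meaning, where `ρ` lists the pairs of corresponding binders that are in scope, innermost first:
either `x` and `y` refer to corresponding binders, or both are free and they are equal. -/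
def AlphaVar : List (Name × Name) → Name → Name → Prop
  | [], x, y => x = y
  | (x', y') :: ρ, x, y => (x = x' ∧ y = y') ∨ (x ≠ x' ∧ y ≠ y' ∧ AlphaVar ρ x y)

/-- Alpha-equivalence below the pairs of corresponding binders listed in `ρ`. -/
def AlphaEqIn : List (Name × Name) → Expression → Expression → Prop
  | ρ, var x, var y => AlphaVar ρ x y
  | ρ, lam x a, lam y c => AlphaEqIn ((x, y) :: ρ) a c
  | ρ, app a₁ a₂, app c₁ c₂ => AlphaEqIn ρ a₁ c₁ ∧ AlphaEqIn ρ a₂ c₂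
  | _, _, _ => False

/-- Alpha-equivalence of expressions: equality up to the names of bound variables. -/
def AlphaEq (a c : Expression) : Prop := AlphaEqIn [] a c

end Expression

/-! ### Hash functions and hash combiners -/

/-- Hash codes are bit strings of length `b`. -/
abbrev HashCode (b : ℕ) := BitVec b

instance instMeasurableSpaceHashCode (b : ℕ) : MeasurableSpace (HashCode b) := ⊤

/-- All possible calls to a hash function or hash combiner. Each constructor is one hash function
or combiner, and its fields are the arguments; a field `size` is the salt, the number of
constructor calls of the object that is being hashed. -/
inductive HashCall (b : ℕ) : Type
  /-- hash of a variable name -/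
  | name (x : Name)
  /-- combiners for the constructors of structures -/
  | sVar
  | sLam (size : HashCode b) (pos : Option (HashCode b)) (body : HashCode b)
  | sApp (size : HashCode b) (leftBigger : Bool) (fn arg : HashCode b)
  /-- combiners for the constructors of position trees -/
  | ptHere
  | ptJoin (size tag : HashCode b) (big : Option (HashCode b)) (small : HashCode b)
  /-- combiner for an entry of a variable map -/
  | entry (name pos : HashCode b)
  /-- top-level combiner for an e-summary -/
  | summary (str vm : HashCode b)

/-- A choice of all the hash functions and hash combiners. -/
abbrev HashFun (b : ℕ) := HashCall b → HashCode b

/-- `P` is the law of a random function from `A` to the finite set `B`: every value is uniform on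
`B`, and the values at distinct arguments are independent. -/
def IsRandomFunction {A B : Type*} [MeasurableSpace B] (P : Measure (A → B)) : Prop :=
  (∀ (a : A) (v : B), P {f | f a = v} = (Nat.card B : ENNReal)⁻¹) ∧
    iIndepFun (fun (a : A) (f : A → B) => f a) P

/-! ### The algorithm, with structures and position trees represented by their hashes -/

/-- A structure is represented by its hash code, together with the number of its constructor calls
(used as salt and as structure tag). -/
structure Structure (b : ℕ) where
  hash : HashCode b
  size : ℕ

/-- A position tree is represented by its hash code, together with the number of its constructor
calls (used as salt). -/
structure PosTree (b : ℕ) where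
  hash : HashCode b
  size : ℕ

section
variable {b : ℕ} (f : HashFun b)

/-- The structure of a variable. -/
def mkSVar : Structure b := ⟨f .sVar, 1⟩

/-- The structure of a lambda, from the positions of the bound variable and the body. -/
def mkSLam (p : Option (PosTree b)) (s : Structure b) : Structure b :=
  let n := s.size + 1
  ⟨f (.sLam (BitVec.ofNat b n) (p.map PosTree.hash) s.hash), n⟩

/-- The structure of an application. -/
def mkSApp (leftBigger : Bool) (s₁ s₂ : Structure b) : Structure b :=
  let n := s₁.size + s₂.size + 1
  ⟨f (.sApp (BitVec.ofNat b n) leftBigger s₁.hash s₂.hash), n⟩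

/-- The tag of a structure: its size, which exceeds the size of all proper sub-structures. -/
def structureTag (s : Structure b) : ℕ := s.size

/-- The position tree of a single occurrence, at the root. -/
def mkPTHere : PosTree b := ⟨f .ptHere, 1⟩

/-- Join of a position tree from the bigger map, if present, and one from the smaller map. -/
def mkPTJoin (tag : ℕ) (big : Option (PosTree b)) (small : PosTree b) : PosTree b :=
  let n := (big.elim 0 PosTree.size) + small.size + 1
  ⟨f (.ptJoin (BitVec.ofNat b n) (BitVec.ofNat b tag) (big.map PosTree.hash) small.hash), n⟩

/-- A variable map: a finite map from names to position trees, stored with its hash. -/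
structure VarMap (b : ℕ) where
  entries : AList (fun _ : Name => PosTree b)
  hash : HashCode b

/-- Hash of an entry of a variable map. -/
def entryHash (key : Name) (pos : PosTree b) : HashCode b :=
  f (.entry (f (.name key)) pos.hash)

/-- The map with a single entry. -/
def singletonVM (key : Name) (pos : PosTree b) : VarMap b :=
  ⟨AList.singleton key pos, entryHash f key pos⟩

/-- Alter the value of a map at a key. -/
def alterVM (g : Option (PosTree b) → PosTree b) (key : Name) (vm : VarMap b) : VarMap b :=
  match vm.entries.lookup key with
  | some old =>
    ⟨vm.entries.insert key (g (some old)),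
      vm.hash ^^^ entryHash f key old ^^^ entryHash f key (g (some old))⟩
  | none =>
    ⟨vm.entries.insert key (g none), vm.hash ^^^ entryHash f key (g none)⟩

/-- Delete a key from a map, and return the value that it had, if any. -/
def removeFromVM (key : Name) (vm : VarMap b) : VarMap b × Option (PosTree b) :=
  match vm.entries.lookup key with
  | some pt => (⟨vm.entries.erase key, vm.hash ^^^ entryHash f key pt⟩, some pt)
  | none => (vm, none)

/-- The number of variables in a map. -/
def sizeVM (vm : VarMap b) : ℕ := vm.entries.entries.length

/-- An e-summary: a structure and a map of the free variables. -/
structure ESummary (b : ℕ) where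
  str : Structure b
  vm : VarMap b

/-- The e-summary of an expression. At an application, the entries of the smaller variable map are
added one by one to the bigger one. -/
def summariseExpr : Expression → ESummary b
  | .var v => ⟨mkSVar f, singletonVM f v (mkPTHere f)⟩
  | .lam x e =>
    let body := summariseExpr e
    let r := removeFromVM f x body.vm
    ⟨mkSLam f r.2 body.str, r.1⟩
  | .app e₁ e₂ =>
    let s₁ := summariseExpr e₁
    let s₂ := summariseExpr e₂
    let leftBigger : Bool := decide (sizeVM s₂.vm < sizeVM s₁.vm)
    let str := mkSApp f leftBigger s₁.str s₂.str
    let tag := structureTag str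
    let big := if leftBigger then s₁.vm else s₂.vm
    let small := if leftBigger then s₂.vm else s₁.vm
    ⟨str, small.entries.entries.foldr
      (fun kv vm => alterVM f (fun mp => mkPTJoin f tag mp kv.2) kv.1 vm) big⟩

/-- The hash code of an e-summary. -/
def hashESummary (s : ESummary b) : HashCode b :=
  f (.summary s.str.hash s.vm.hash)

/-- The set of classes of subexpressions (as sets of nodes) that the algorithm outputs: nodes are
put into the same class when the hash codes of their e-summaries are equal. -/
def recoveredClasses (e : Expression) : Set (Set e.Node) :=
  Set.range fun i : e.Node =>
    {j | hashESummary f (summariseExpr f (e.at_ i)) = hashESummary f (summariseExpr f (e.at_ j))}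

end

/-- The set of alpha-equivalence classes of the subexpressions (as sets of nodes). -/
def alphaClasses (e : Expression) : Set (Set e.Node) :=
  Set.range fun i : e.Node => {j | (e.at_ i).AlphaEq (e.at_ j)}

end AlphaHash

/-!
Before hashing, structures and position trees are trees over `Label`, and an expression is
determined up to alpha-equivalence by its structure `Expression.shape` and its variable map
`Expression.positions`: the tag of a join is larger than all tags below it, so a merged map can be
split again. The algorithm computes the hash codes of exactly these objects.

Consider the last calls made when two distinct trees are hashed, and take the one whose label has
the larger rank. The sizes that are passed along as salts keep it apart from all calls below the
two roots, so its value can be resampled without changing the arguments of either call. Hence the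
two calls collide with probability at most `2⁻ᵇ` unless their arguments agree, and by induction two
distinct trees collide with probability at most `2⁻ᵇ` times the height of either.

For variable maps that differ at `x`, the same resampling is applied to the entry of `x`, once the
hash code of the name `x` is known to differ from those of the other names. A pair of subexpressions
of `e` that are not alpha-equivalent then collides with probability at most `(2|e| + 1) 2⁻ᵇ`, and
there are at most `|e|²` pairs.
-/

namespace AlphaHash

section RandomFunction

variable {A B C D : Type*}

/-- `X`, a quantity computed from a function, looks at only finitely many of its values. This
stands in for measurability: the law of a random function determines the distribution of such a
quantity by counting. -/
def FinitelyDetermined (X : (A → B) → C) : Prop :=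
  ∃ S : Finset A, DependsOn X (S : Set A)

namespace FinitelyDetermined

theorem const (c : C) : FinitelyDetermined fun _ : A → B => c :=
  ⟨∅, (dependsOn_const c).mono (Set.empty_subset _)⟩

theorem comp₂ {E : Type*} (φ : C → D → E) {X : (A → B) → C} {Y : (A → B) → D}
    (hX : FinitelyDetermined X) (hY : FinitelyDetermined Y) :
    FinitelyDetermined fun f => φ (X f) (Y f) := by
  classical
  obtain ⟨S, hS⟩ := hX
  obtain ⟨T, hT⟩ := hY
  refine ⟨S ∪ T, fun f f' h => ?_⟩
  rw [Finset.coe_union] at h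
  exact congrArg₂ φ (hS fun a ha => h a (.inl ha)) (hT fun a ha => h a (.inr ha))

theorem comp (φ : C → D) {X : (A → B) → C} (hX : FinitelyDetermined X) :
    FinitelyDetermined fun f => φ (X f) :=
  hX.imp fun _ hS _ _ h => congrArg φ (hS h)

theorem finite_range [Finite B] {X : (A → B) → C} (hX : FinitelyDetermined X) :
    (Set.range X).Finite := by
  obtain ⟨S, hS⟩ := hX
  rcases isEmpty_or_nonempty C with _ | _
  · exact Set.toFinite _
  · obtain ⟨g, rfl⟩ := dependsOn_iff_exists_comp.1 hS
    exact (Set.finite_range g).subset (Set.range_comp_subset_range _ _)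

theorem apply [Finite B] {X : (A → B) → A} (hX : FinitelyDetermined X) :
    FinitelyDetermined fun f => f (X f) := by
  classical
  obtain ⟨S, hS⟩ := id hX
  refine ⟨S ∪ hX.finite_range.toFinset, fun f f' h => ?_⟩
  have hXf : X f = X f' := hS fun a ha => h a (by simp [Finset.mem_coe.1 ha])
  exact (h (X f) (by simp)).trans (congrArg f' hXf)

theorem of_forall_mem {ι : Type*} (s : Finset ι) {X : ι → (A → B) → C} {Y : (A → B) → D}
    (hX : ∀ i, FinitelyDetermined (X i))
    (hY : ∀ f f', (∀ i ∈ s, X i f = X i f') → Y f = Y f') : FinitelyDetermined Y := by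
  classical
  choose S hS using hX
  exact ⟨s.biUnion S, fun f f' h => hY f f' fun i hi =>
    hS i fun a ha => h a (Finset.mem_biUnion.2 ⟨i, hi, ha⟩)⟩

end FinitelyDetermined

/-- Sending `(f, v)` to `f` with its value at `a f` replaced by `v` is injective on `E × B`, as
`f (a f)` can be read off from the result. -/
theorem ncard_mul_card_le_of_resample [Finite A] [Finite B] {E : Set (A → B)}
    {a : (A → B) → A} {g : (A → B) → B} (hE : ∀ f ∈ E, f (a f) = g f)
    (hag : ∀ f ∈ E, ∀ f', Set.EqOn f' f {a f}ᶜ → a f' = a f ∧ g f' = g f) :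
    E.ncard * Nat.card B ≤ Nat.card (A → B) := by
  classical
  have eqOn_update (f : A → B) (v : B) : Set.EqOn (Function.update f (a f) v) f {a f}ᶜ :=
    fun c hc => Function.update_of_ne hc v f
  rw [← Set.ncard_univ, ← Set.ncard_univ, ← Set.ncard_prod]
  refine Set.ncard_le_ncard_of_injOn (fun x => Function.update x.1 (a x.1) x.2)
    (fun _ _ => Set.mem_univ _) ?_
  rintro ⟨f, v⟩ ⟨hf, -⟩ ⟨f', v'⟩ ⟨hf', -⟩ (h : Function.update f _ v = Function.update f' _ v')
  obtain ⟨ha, hg⟩ := hag f hf _ (eqOn_update f v)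
  obtain ⟨ha', hg'⟩ := hag f' hf' _ (eqOn_update f' v')
  have haa : a f = a f' := by rw [← ha, h, ha']
  have hgg : g f = g f' := by rw [← hg, h, hg']
  have hff : f = f' := by
    funext c
    by_cases hc : c = a f
    · rw [hc, hE f hf, haa, hE f' hf', hgg]
    · rw [← eqOn_update f v hc, h, eqOn_update f' v' (haa ▸ hc)]
  have hvv : v = v' := by simpa [haa] using congrFun h (a f)
  rw [hff, hvv]

theorem exists_isRandomFunction (A B : Type*) [Finite B] [Nonempty B] [MeasurableSpace B]
    [MeasurableSingletonClass B] :
    ∃ P : Measure (A → B), IsProbabilityMeasure P ∧ IsRandomFunction P := by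
  have := Fintype.ofFinite B
  let μ : Measure B := uniformOn Set.univ
  have : IsProbabilityMeasure μ := isProbabilityMeasure_uniformOn Set.finite_univ Set.univ_nonempty
  refine ⟨Measure.infinitePi fun _ : A => μ, inferInstance, fun a v => ?_,
    iIndepFun_infinitePi (X := fun _ (x : B) => x) fun _ => measurable_id⟩
  calc Measure.infinitePi (fun _ : A => μ) (Function.eval a ⁻¹' {v})
    _ = μ {v} := (measurePreserving_eval_infinitePi (fun _ : A => μ) a).measure_preimage
        (measurableSet_singleton v).nullMeasurableSet
    _ = (Nat.card B : ENNReal)⁻¹ := by simp [μ, uniformOn_univ, Nat.card_eq_fintype_card]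

namespace IsRandomFunction

variable [Finite B] [MeasurableSpace B] [MeasurableSingletonClass B] {P : Measure (A → B)}

theorem measureReal_restrict_preimage_le (hP : IsRandomFunction P) (S : Finset A)
    (E : Set (S → B)) :
    P.real (S.restrict ⁻¹' E) ≤ E.ncard / Nat.card (S → B) := by
  have := hP.2.isProbabilityMeasure
  have cylinder (u : S → B) :
      P.real (S.restrict ⁻¹' ({u} : Set (S → B))) = (Nat.card (S → B) : ℝ)⁻¹ := by
    have h : S.restrict ⁻¹' ({u} : Set (S → B)) =
        ⋂ a ∈ (Finset.univ : Finset S), (fun f : A → B => f a) ⁻¹' {u a} := by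
      ext f
      simp [funext_iff]
    have hind : iIndepFun (fun (a : S) (f : A → B) => f a) P :=
      hP.2.precomp Subtype.val_injective
    rw [measureReal_def, h, hind.measure_inter_preimage_eq_mul Finset.univ
      fun a _ => measurableSet_singleton (u a)]
    simp [hP.1 _ _, Set.preimage, Nat.card_fun]
  calc P.real (S.restrict ⁻¹' E)
    _ = P.real (⋃ u ∈ E.toFinite.toFinset, S.restrict ⁻¹' {u}) := by
        congr 1
        ext f
        simp
    _ ≤ ∑ u ∈ E.toFinite.toFinset, P.real (S.restrict ⁻¹' {u}) :=
        measureReal_biUnion_finset_le _ _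
    _ = E.ncard / Nat.card (S → B) := by
        simp only [cylinder, Finset.sum_const, nsmul_eq_mul, div_eq_mul_inv,
          Set.ncard_eq_toFinset_card E]

/-- The resampling principle: `a` and `g` do not see the value of `f` at `a f`, so this value is
still uniform when `a f` and `g f` are given. -/
theorem measureReal_le_of_resample (hP : IsRandomFunction P) {E : Set (A → B)}
    (hEfin : FinitelyDetermined (· ∈ E)) {a : (A → B) → A} (ha : FinitelyDetermined a)
    {g : (A → B) → B} (hE : ∀ f ∈ E, f (a f) = g f)
    (hag : ∀ f ∈ E, ∀ f', Set.EqOn f' f {a f}ᶜ → a f' = a f ∧ g f' = g f) :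
    P.real E ≤ (Nat.card B : ℝ)⁻¹ := by
  classical
  rcases E.eq_empty_or_nonempty with rfl | ⟨f₀, -⟩
  · simp
  obtain ⟨T, hT⟩ := hEfin
  set S : Finset A := T ∪ ha.finite_range.toFinset
  let extend (u : S → B) : A → B := Function.extend (↑) u f₀
  have extend_coe (u : S → B) (s : S) : extend u s = u s :=
    Subtype.val_injective.extend_apply u f₀ s
  have mem_S (f : A → B) : a f ∈ S := by simp [S]
  have key : (extend ⁻¹' E).ncard * Nat.card B ≤ Nat.card (S → B) := by
    refine ncard_mul_card_le_of_resample (a := fun u => ⟨a (extend u), mem_S _⟩)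
      (g := fun u => g (extend u)) (fun u hu => ?_) fun u hu u' h => ?_
    · exact (extend_coe u _).symm.trans (hE _ hu)
    · have hext : Set.EqOn (extend u') (extend u) {a (extend u)}ᶜ := by
        intro c hc
        by_cases hcS : c ∈ S
        · lift c to S using hcS
          rw [extend_coe, extend_coe]
          exact h fun hcu => hc (congrArg Subtype.val hcu)
        · have hc' : ¬ ∃ s : S, (s : A) = c := by simpa using hcS
          simp only [extend, Function.extend_apply' _ _ _ hc']
      simpa only [Subtype.mk.injEq] using hag _ hu _ hext
  have hrestrict : E ⊆ S.restrict ⁻¹' (extend ⁻¹' E) := by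
    intro f hf
    refine (hT fun c hc => ?_).mp hf
    exact (extend_coe (S.restrict f) ⟨c, Finset.mem_union_left _ hc⟩).symm
  have := hP.2.isProbabilityMeasure
  have hB : Nonempty B := ⟨f₀ (a f₀)⟩
  calc P.real E
    _ ≤ P.real (S.restrict ⁻¹' (extend ⁻¹' E)) := measureReal_mono hrestrict
    _ ≤ (extend ⁻¹' E).ncard / Nat.card (S → B) := hP.measureReal_restrict_preimage_le S _
    _ ≤ (Nat.card B : ℝ)⁻¹ := by
        rw [div_le_iff₀ (by exact_mod_cast Nat.card_pos), inv_mul_eq_div,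
          le_div_iff₀ (by exact_mod_cast Nat.card_pos)]
        exact_mod_cast key

theorem measureReal_collision_le (hP : IsRandomFunction P) {a a' : (A → B) → A}
    (ha : FinitelyDetermined a) (ha' : FinitelyDetermined a')
    (h : ∀ f f', Set.EqOn f' f {a f}ᶜ → a f' = a f ∧ a' f' = a' f) :
    P.real {f | a f ≠ a' f ∧ f (a f) = f (a' f)} ≤ (Nat.card B : ℝ)⁻¹ := by
  refine hP.measureReal_le_of_resample ?_ ha (fun f hf => hf.2) fun f hf f' hff' => ?_
  · exact (FinitelyDetermined.comp₂ (· ≠ ·) ha ha').comp₂ And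
      (FinitelyDetermined.comp₂ (· = ·) ha.apply ha'.apply)
  · obtain ⟨haf, haf'⟩ := h f f' hff'
    exact ⟨haf, by rw [haf', hff' hf.1.symm]⟩

end IsRandomFunction

end RandomFunction

section Trees

/-- The constructors of position trees and of structures, with the natural numbers and flags that
they pass to their hash combiners. -/
inductive Label : Type
  | here
  | join (size tag : ℕ)
  | var
  | lam (size : ℕ)
  | app (size : ℕ) (leftBigger : Bool)

/-- Position trees and structures before hashing. The empty tree stands for `⊥`, and also fills the
places of the children that `Label.here` and `Label.var` do not have. -/
abbrev Term : Type := BinaryTree Label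

namespace Label

/-- The call to a hash combiner that a constructor makes, given the hash codes of the children. -/
def call {b : ℕ} : Label → Option (HashCode b) → Option (HashCode b) → HashCall b
  | here, _, _ => .ptHere
  | join n t, p, q => .ptJoin (BitVec.ofNat b n) (BitVec.ofNat b t) p (q.getD 0)
  | var, _, _ => .sVar
  | lam n, p, s => .sLam (BitVec.ofNat b n) p (s.getD 0)
  | app n β, s₁, s₂ => .sApp (BitVec.ofNat b n) β (s₁.getD 0) (s₂.getD 0)

/-- A measure that strictly decreases from a node to its descendants, in position trees of size at
most `M` and in structures containing such position trees. Bounded labels of different ranks never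
make the same call. -/
def rank (M : ℕ) : Label → ℕ
  | here => 1
  | join n _ => n
  | var => M + 1
  | lam n => M + n
  | app n _ => M + n

/-- All natural numbers in the label are at most `M`, so that for `M < 2 ^ b` none is changed by
reduction modulo `2 ^ b`. -/
def Bounded (M : ℕ) : Label → Prop
  | join n t => n ≤ M ∧ t ≤ M
  | lam n => n ≤ M
  | app n _ => n ≤ M
  | _ => True

/-- The children of a node are absent or present as its label demands. -/
def Arity : Label → Term → Term → Prop
  | here, l, r => l = .nil ∧ r = .nil
  | var, l, r => l = .nil ∧ r = .nil
  | join _ _, _, r => r ≠ .nil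
  | lam _, _, r => r ≠ .nil
  | app _ _, l, r => l ≠ .nil ∧ r ≠ .nil

end Label

/-- The labels that occur in a tree. -/
def labels : Term → Set Label
  | .nil => ∅
  | .node ℓ l r => {ℓ} ∪ (labels l ∪ labels r)

/-- The trees on which hashing is analysed: labels are bounded by `M`, have the right children, and
have larger rank than all labels below them. -/
def WellFormed (M : ℕ) : Term → Prop
  | .nil => True
  | .node ℓ l r => ℓ.Bounded M ∧ ℓ.Arity l r ∧
      (∀ m ∈ labels l ∪ labels r, m.rank M < ℓ.rank M) ∧ WellFormed M l ∧ WellFormed M r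

variable {b : ℕ}

/-- The hash code of a tree, where `⊥` has none. -/
def hashTree (f : HashFun b) : Term → Option (HashCode b)
  | .nil => none
  | .node ℓ l r => some (f (ℓ.call (hashTree f l) (hashTree f r)))

/-- The last call made when hashing the tree `.node ℓ l r`. -/
def rootCall (f : HashFun b) (ℓ : Label) (l r : Term) : HashCall b :=
  ℓ.call (hashTree f l) (hashTree f r)

theorem hashTree_node (f : HashFun b) (ℓ : Label) (l r : Term) :
    hashTree f (.node ℓ l r) = some (f (rootCall f ℓ l r)) := rfl

theorem hashTree_eq_none {f : HashFun b} {t : Term} : hashTree f t = none ↔ t = .nil := by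
  cases t <;> simp [hashTree]

theorem hashTree_eq_of_getD_eq {f : HashFun b} {t t' : Term} (ht : t ≠ .nil) (ht' : t' ≠ .nil)
    (h : (hashTree f t).getD 0 = (hashTree f t').getD 0) : hashTree f t = hashTree f t' := by
  cases t <;> cases t' <;> simp_all [hashTree]

theorem hashTree_congr {f g : HashFun b} {t : Term}
    (h : ∀ ℓ ∈ labels t, ∀ p q, f (ℓ.call p q) = g (ℓ.call p q)) :
    hashTree f t = hashTree g t := by
  induction t with
  | nil => rfl
  | node ℓ l r ihl ihr =>
    rw [hashTree, hashTree, ihl fun m hm => h m (.inr (.inl hm)),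
      ihr fun m hm => h m (.inr (.inr hm)), h ℓ (.inl rfl)]

theorem finitelyDetermined_hashTree (t : Term) :
    FinitelyDetermined fun f : HashFun b => hashTree f t := by
  induction t with
  | nil => exact .const none
  | node ℓ l r ihl ihr => exact (ihl.comp₂ ℓ.call ihr).apply.comp some

theorem finitelyDetermined_rootCall (ℓ : Label) (l r : Term) :
    FinitelyDetermined fun f : HashFun b => rootCall f ℓ l r :=
  (finitelyDetermined_hashTree l).comp₂ ℓ.call (finitelyDetermined_hashTree r)

theorem ofNat_injOn {M : ℕ} (hM : M < 2 ^ b) : Set.InjOn (BitVec.ofNat b) (Set.Iic M) := by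
  intro m hm n hn h
  have hmod := congrArg BitVec.toNat h
  rwa [BitVec.toNat_ofNat, BitVec.toNat_ofNat, Nat.mod_eq_of_lt (hm.trans_lt hM),
    Nat.mod_eq_of_lt (hn.trans_lt hM)] at hmod

theorem Label.call_ne_call {M : ℕ} (hM : M < 2 ^ b) {ℓ m : Label} (hℓ : ℓ.Bounded M)
    (hmℓ : m.rank M < ℓ.rank M) (p q p' q' : Option (HashCode b)) :
    m.call p q ≠ ℓ.call p' q' := by
  have ofNat_ne {n n' : ℕ} (hn' : n' ≤ M) (h : n < n') : BitVec.ofNat b n ≠ BitVec.ofNat b n' :=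
    fun he => h.ne (ofNat_injOn hM (h.le.trans hn') hn' he)
  cases m <;> cases ℓ <;> simp only [Label.rank, Label.Bounded] at hmℓ hℓ <;>
    simp only [Label.call, ne_eq, reduceCtorEq, not_false_eq_true, HashCall.ptJoin.injEq,
      HashCall.sLam.injEq, HashCall.sApp.injEq]
  all_goals grind

theorem rootCall_inj {M : ℕ} (hM : M < 2 ^ b) {ℓ ℓ' : Label} {l r l' r' : Term}
    (hx : WellFormed M (.node ℓ l r)) (hy : WellFormed M (.node ℓ' l' r')) {f : HashFun b}
    (h : rootCall f ℓ l r = rootCall f ℓ' l' r') :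
    ℓ = ℓ' ∧ hashTree f l = hashTree f l' ∧ hashTree f r = hashTree f r' := by
  obtain ⟨hℓ, hlr, -⟩ := hx
  obtain ⟨hℓ', hlr', -⟩ := hy
  have ofNat_inj {n n' : ℕ} (hn : n ≤ M) (hn' : n' ≤ M)
      (he : BitVec.ofNat b n = BitVec.ofNat b n') : n = n' := ofNat_injOn hM hn hn' he
  cases ℓ <;> cases ℓ' <;> simp only [rootCall, Label.call, reduceCtorEq, HashCall.ptJoin.injEq,
    HashCall.sLam.injEq, HashCall.sApp.injEq] at h <;>
    simp only [Label.Bounded, Label.Arity] at hℓ hℓ' hlr hlr'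
  all_goals grind [hashTree_eq_of_getD_eq]

theorem rootCall_congr {M : ℕ} (hM : M < 2 ^ b) {ℓ m : Label} (hℓ : ℓ.Bounded M) {l r : Term}
    (hm : ∀ k ∈ labels l ∪ labels r, k.rank M < ℓ.rank M) {f f' : HashFun b}
    {p q : Option (HashCode b)} (h : Set.EqOn f' f {ℓ.call p q}ᶜ) :
    rootCall f' m l r = rootCall f m l r := by
  have h' : ∀ k ∈ labels l ∪ labels r, ∀ p q, f' (k.call p q) = f (k.call p q) :=
    fun k hk p' q' => h (Label.call_ne_call hM hℓ (hm k hk) p' q' p q)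
  rw [rootCall, hashTree_congr fun k hk => h' k (.inl hk),
    hashTree_congr fun k hk => h' k (.inr hk), rootCall]

end Trees

section Collision

variable {b : ℕ} {P : Measure (HashFun b)}

theorem inv_card_hashCode (b : ℕ) : (Nat.card (HashCode b) : ℝ)⁻¹ = 1 / 2 ^ b := by
  rw [Nat.card_congr BitVec.equivFin.toEquiv, Nat.card_fin, one_div, Nat.cast_pow, Nat.cast_ofNat]

theorem measureReal_rootCall_collision_le (hP : IsRandomFunction P) {M : ℕ} (hM : M < 2 ^ b)
    {ℓ ℓ' : Label} {l r l' r' : Term} (hx : WellFormed M (.node ℓ l r))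
    (hy : WellFormed M (.node ℓ' l' r')) :
    P.real {f | rootCall f ℓ l r ≠ rootCall f ℓ' l' r' ∧
      f (rootCall f ℓ l r) = f (rootCall f ℓ' l' r')} ≤ 1 / 2 ^ b := by
  wlog hrank : ℓ'.rank M ≤ ℓ.rank M generalizing ℓ ℓ' l r l' r'
  · simpa only [ne_comm, eq_comm] using this hy hx (le_of_not_ge hrank)
  have hℓ := hx.1
  refine (hP.measureReal_collision_le (finitelyDetermined_rootCall ℓ l r)
    (finitelyDetermined_rootCall ℓ' l' r') fun f f' h => ⟨?_, ?_⟩).trans_eq ?_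
  · exact rootCall_congr hM hℓ hx.2.2.1 h
  · exact rootCall_congr hM hℓ (fun m hm => (hy.2.2.1 m hm).trans_le hrank) h
  · exact inv_card_hashCode b

theorem measureReal_hashTree_eq_le (hP : IsRandomFunction P) {M : ℕ} (hM : M < 2 ^ b) {x y : Term}
    (hx : WellFormed M x) (hy : WellFormed M y) (hxy : x ≠ y) :
    P.real {f | hashTree f x = hashTree f y} ≤ x.height / 2 ^ b := by
  have := hP.2.isProbabilityMeasure
  induction x generalizing y with
  | nil =>
    have h : {f : HashFun b | hashTree f .nil = hashTree f y} = ∅ :=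
      Set.eq_empty_of_forall_notMem fun f hf => hxy (hashTree_eq_none.1 hf.symm).symm
    simp [h]
  | node ℓ l r ihl ihr =>
  cases y with
  | nil =>
    simp only [hashTree, reduceCtorEq, Set.ofPred_false, measureReal_empty]
    positivity
  | node ℓ' l' r' =>
  have hchild : P.real {f | rootCall f ℓ l r = rootCall f ℓ' l' r'} ≤
      max l.height r.height / 2 ^ b := by
    have inj {f : HashFun b} := rootCall_inj (f := f) hM hx hy
    by_cases hl : l = l'
    · by_cases hr : r = r'
      · have h : {f : HashFun b | rootCall f ℓ l r = rootCall f ℓ' l' r'} = ∅ :=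
          Set.eq_empty_of_forall_notMem fun f hf => hxy (by rw [(inj hf).1, hl, hr])
        rw [h, measureReal_empty]
        positivity
      · refine (measureReal_mono fun f hf => (inj hf).2.2).trans
          ((ihr hx.2.2.2.2 hy.2.2.2.2 hr).trans ?_)
        gcongr
        exact le_max_right _ _
    · refine (measureReal_mono fun f hf => (inj hf).2.1).trans
        ((ihl hx.2.2.2.1 hy.2.2.2.1 hl).trans ?_)
      gcongr
      exact le_max_left _ _
  calc P.real {f | hashTree f (.node ℓ l r) = hashTree f (.node ℓ' l' r')}
    _ ≤ P.real ({f | rootCall f ℓ l r = rootCall f ℓ' l' r'} ∪ {f | rootCall f ℓ l r ≠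
        rootCall f ℓ' l' r' ∧ f (rootCall f ℓ l r) = f (rootCall f ℓ' l' r')}) := by
      refine measureReal_mono fun f hf => or_iff_not_imp_left.2 fun hne => ⟨hne, ?_⟩
      simpa only [Set.mem_ofPred_eq, hashTree_node, Option.some_inj] using hf
    _ ≤ max l.height r.height / 2 ^ b + 1 / 2 ^ b := (measureReal_union_le _ _).trans
      (add_le_add hchild (measureReal_rootCall_collision_le hP hM hx hy))
    _ = (BinaryTree.node ℓ l r).height / 2 ^ b := by
      rw [BinaryTree.height, Nat.cast_add, Nat.cast_max, Nat.cast_one, add_div]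

end Collision

section VariableMaps

/-- The variables that have an entry in a variable map, where `.nil` stands for a missing entry. -/
def support (V : Name → Term) : Set Name := {y | V y ≠ .nil}

/-- Whether the first variable map has more entries than the second one. -/
noncomputable def moreEntries (V W : Name → Term) : Bool :=
  decide ((support W).ncard < (support V).ncard)

/-- The position tree of a variable at an application of size `t`, from those in the bigger and in
the smaller map; the bigger map is left alone where the smaller one has no entry. -/
def combine (t : ℕ) (big : Term) : Term → Term
  | .nil => big
  | .node ℓ l r => .node (.join (big.numNodes + (BinaryTree.node ℓ l r).numNodes + 1) t) big
      (.node ℓ l r)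

/-- The variable map of an application of size `t`, from those of function and argument. -/
noncomputable def mergeMaps (t : ℕ) (V W : Name → Term) : Name → Term :=
  if moreEntries V W then fun y => combine t (V y) (W y) else fun y => combine t (W y) (V y)

theorem combine_of_ne_nil {t : ℕ} {p q : Term} (hq : q ≠ .nil) :
    combine t p q = .node (.join (p.numNodes + q.numNodes + 1) t) p q := by
  cases q with
  | nil => contradiction
  | node ℓ l r => rfl

theorem combine_ne_nil_iff {t : ℕ} {p q : Term} :
    combine t p q ≠ .nil ↔ p ≠ .nil ∨ q ≠ .nil := by
  cases q <;> simp [combine]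

theorem numNodes_combine_le (t : ℕ) (p q : Term) :
    (combine t p q).numNodes ≤ p.numNodes + q.numNodes + 1 := by
  cases q <;> simp [combine]

/-- A tag that exceeds all tags in `p` and `p'` shows whether `combine` has added a node. -/
theorem combine_inj {M t : ℕ} (hMt : M < t) {p q p' q' : Term} (hp : WellFormed M p)
    (hp' : WellFormed M p') : combine t p q = combine t p' q' ↔ p = p' ∧ q = q' := by
  have ne_node {n : ℕ} {p l r : Term} (hp : WellFormed M p) : p ≠ .node (.join n t) l r := by
    rintro rfl
    exact hMt.not_ge hp.1.2
  refine ⟨fun h => ?_, fun ⟨hpp', hqq'⟩ => hpp' ▸ hqq' ▸ rfl⟩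
  cases q <;> cases q'
  · exact ⟨h, rfl⟩
  · exact absurd h (ne_node hp)
  · exact absurd h.symm (ne_node hp')
  · exact ⟨(BinaryTree.node.inj h).2.1, (BinaryTree.node.inj h).2.2⟩

theorem support_mergeMaps (t : ℕ) (V W : Name → Term) :
    support (mergeMaps t V W) = support V ∪ support W := by
  ext y
  unfold mergeMaps
  split_ifs
  · exact combine_ne_nil_iff
  · exact combine_ne_nil_iff.trans or_comm

theorem numNodes_mergeMaps_le (t : ℕ) (V W : Name → Term) (y : Name) :
    (mergeMaps t V W y).numNodes ≤ (V y).numNodes + (W y).numNodes + 1 := by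
  unfold mergeMaps
  split_ifs
  · exact numNodes_combine_le t _ _
  · exact (numNodes_combine_le t _ _).trans_eq (by rw [Nat.add_comm (W y).numNodes])

/-- A position tree that is well-formed as part of an expression of size `M`. -/
structure IsPosition (M : ℕ) (p : Term) : Prop where
  wellFormed : WellFormed M p
  rank_le : ∀ ℓ ∈ labels p, ℓ.rank M ≤ p.numNodes

namespace IsPosition

variable {M t : ℕ}

theorem nil : IsPosition M .nil := ⟨trivial, fun _ h => h.elim⟩

theorem here : IsPosition M (.node .here .nil .nil) where
  wellFormed := ⟨trivial, ⟨rfl, rfl⟩, by simp [labels], trivial, trivial⟩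
  rank_le := by simp [labels, Label.rank]

theorem combine {p q : Term} (hp : IsPosition M p) (hq : IsPosition M q) (ht : t ≤ M)
    (hn : p.numNodes + q.numNodes + 1 ≤ M) : IsPosition M (combine t p q) := by
  by_cases hq_nil : q = .nil
  · rwa [hq_nil]
  have rank_lt : ∀ ℓ ∈ labels p ∪ labels q, ℓ.rank M < p.numNodes + q.numNodes + 1 := by
    rintro ℓ (h | h)
    · have := hp.rank_le ℓ h
      lia
    · have := hq.rank_le ℓ h
      lia
  rw [combine_of_ne_nil hq_nil]
  refine ⟨⟨⟨hn, ht⟩, hq_nil, rank_lt, hp.wellFormed, hq.wellFormed⟩, ?_⟩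
  rintro ℓ (rfl | h)
  · exact le_rfl
  · exact (rank_lt ℓ h).le

theorem mergeMaps {V W : Name → Term} {y : Name} (hV : IsPosition M (V y))
    (hW : IsPosition M (W y)) (ht : t ≤ M) (hn : (V y).numNodes + (W y).numNodes + 1 ≤ M) :
    IsPosition M (mergeMaps t V W y) := by
  unfold AlphaHash.mergeMaps
  split_ifs
  · exact hV.combine hW ht hn
  · exact hW.combine hV ht (by rwa [Nat.add_comm (W y).numNodes])

end IsPosition

end VariableMaps

namespace Expression

/-- All variables that occur in an expression, free or bound, except as binders. -/
def vars : Expression → Finset Name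
  | var x => {x}
  | lam _ a => a.vars
  | app a c => a.vars ∪ c.vars

/-- The variable map of an expression before hashing. -/
noncomputable def positions : Expression → Name → Term
  | var x => Function.update (fun _ => .nil) x (.node .here .nil .nil)
  | lam x a => Function.update a.positions x .nil
  | app a c => mergeMaps (a.size + c.size + 1) a.positions c.positions

/-- The structure of an expression before hashing. -/
noncomputable def shape : Expression → Term
  | var _ => .node .var .nil .nil
  | lam x a => .node (.lam (a.size + 1)) (a.positions x) a.shape
  | app a c => .node (.app (a.size + c.size + 1) (moreEntries a.positions c.positions))
      a.shape c.shape

theorem card_vars_le (a : Expression) : a.vars.card ≤ a.size := by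
  induction a with
  | var x => simp [vars, size]
  | lam x a ih => exact ih.trans (Nat.le_succ _)
  | app a c iha ihc =>
    exact (Finset.card_union_le _ _).trans ((Nat.add_le_add iha ihc).trans (Nat.le_succ _))

theorem support_positions_subset (a : Expression) : support a.positions ⊆ a.vars := by
  induction a with
  | var x =>
    intro y hy
    by_contra hyx
    exact hy (Function.update_of_ne (by simpa [vars] using hyx) _ _)
  | lam x a ih =>
    intro y hy
    obtain rfl | hyx := eq_or_ne y x
    · exact absurd (Function.update_self ..) hy
    · exact ih ((Function.update_of_ne hyx _ _).symm.trans_ne hy)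
  | app a c iha ihc =>
    rw [positions, support_mergeMaps, vars, Finset.coe_union]
    exact Set.union_subset_union iha ihc

theorem numNodes_positions_le (a : Expression) (y : Name) :
    (a.positions y).numNodes ≤ a.size := by
  induction a with
  | var x => by_cases h : y = x <;> simp [positions, size, h]
  | lam x a ih => by_cases h : y = x <;> simp [positions, size, h, Nat.le_succ_of_le ih]
  | app a c iha ihc =>
    have := numNodes_mergeMaps_le (a.size + c.size + 1) a.positions c.positions y
    simp only [positions, size]
    lia

theorem isPosition_positions {M : ℕ} {a : Expression} (ha : a.size ≤ M) (y : Name) :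
    IsPosition M (a.positions y) := by
  induction a with
  | var x =>
    by_cases h : y = x
    · simpa [positions, h] using .here
    · simpa [positions, h] using .nil
  | lam x a ih =>
    by_cases h : y = x
    · simpa [positions, h] using .nil
    · simpa [positions, h] using ih (Nat.le_of_succ_le ha)
  | app a c iha ihc =>
    have := numNodes_positions_le a y
    have := numNodes_positions_le c y
    rw [size] at ha
    exact (iha (by lia)).mergeMaps (ihc (by lia)) ha (by lia)

theorem shape_ne_nil (a : Expression) : a.shape ≠ .nil := by
  cases a <;> simp [shape]

theorem height_shape_le (a : Expression) : a.shape.height ≤ a.size := by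
  induction a with
  | var x => simp [shape, size]
  | lam x a ih =>
    have := (BinaryTree.height_le_numNodes _).trans (numNodes_positions_le a x)
    exact Nat.succ_le_succ (max_le this ih)
  | app a c iha ihc =>
    simp only [shape, size, BinaryTree.height]
    lia

theorem rank_le_of_mem_labels_shape {M : ℕ} {a : Expression} (ha : a.size ≤ M) {ℓ : Label}
    (hℓ : ℓ ∈ labels a.shape) : ℓ.rank M ≤ M + a.size := by
  induction a with
  | var x =>
    obtain rfl : ℓ = .var := by simpa [shape, labels] using hℓ
    exact le_rfl
  | lam x a ih =>
    rw [size] at ha ⊢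
    rcases hℓ with rfl | hℓ | hℓ
    · exact le_rfl
    · have := (isPosition_positions (Nat.le_of_succ_le ha) x).rank_le ℓ hℓ
      have := numNodes_positions_le a x
      lia
    · have := ih (Nat.le_of_succ_le ha) hℓ
      lia
  | app a c iha ihc =>
    rw [size] at ha ⊢
    rcases hℓ with rfl | hℓ | hℓ
    · exact le_rfl
    · have := iha (by lia) hℓ
      lia
    · have := ihc (by lia) hℓ
      lia

theorem wellFormed_shape {M : ℕ} {a : Expression} (ha : a.size ≤ M) : WellFormed M a.shape := by
  induction a with
  | var x => exact ⟨trivial, ⟨rfl, rfl⟩, by simp [labels], trivial, trivial⟩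
  | lam x a ih =>
    have ha' : a.size ≤ M := Nat.le_of_succ_le ha
    refine ⟨ha, a.shape_ne_nil, ?_, (isPosition_positions ha' x).wellFormed, ih ha'⟩
    rintro ℓ (hℓ | hℓ)
    · have := (isPosition_positions ha' x).rank_le ℓ hℓ
      have := numNodes_positions_le a x
      change ℓ.rank M < M + (a.size + 1)
      lia
    · exact Nat.lt_succ_of_le (rank_le_of_mem_labels_shape ha' hℓ)
  | app a c iha ihc =>
    rw [size] at ha
    refine ⟨ha, ⟨a.shape_ne_nil, c.shape_ne_nil⟩, ?_, iha (by lia), ihc (by lia)⟩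
    rintro ℓ hℓ
    change ℓ.rank M < M + (a.size + c.size + 1)
    rcases hℓ with hℓ | hℓ
    · have := rank_le_of_mem_labels_shape (M := M) (by lia) hℓ
      lia
    · have := rank_le_of_mem_labels_shape (M := M) (by lia) hℓ
      lia

theorem size_eq_of_shape_eq {a c : Expression} (h : a.shape = c.shape) : a.size = c.size := by
  cases a <;> cases c <;> simp_all [shape, size]

theorem size_pos (a : Expression) : 0 < a.size := by
  cases a <;> simp [size]

theorem length_subexprs (e : Expression) : e.subexprs.length = e.size := by
  induction e <;> simp_all [subexprs, size]

theorem size_le_of_mem_subexprs {a e : Expression} (h : a ∈ e.subexprs) : a.size ≤ e.size := by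
  induction e <;> grind [subexprs, size]

theorem vars_subset_of_mem_subexprs {a e : Expression} (h : a ∈ e.subexprs) :
    a.vars ⊆ e.vars := by
  induction e <;> grind [subexprs, vars]

end Expression

section AlphaEquivalence

open Expression

theorem Expression.AlphaVar.eq_iff {ρ : List (Name × Name)} {x y x' y' : Name}
    (h : AlphaVar ρ x y) (h' : AlphaVar ρ x' y') : x = x' ↔ y = y' := by
  induction ρ with
  | nil => exact h ▸ h' ▸ Iff.rfl
  | cons r ρ ih =>
    simp only [AlphaVar] at h h'
    grind

/-- The entries of two variable maps are the same, up to the correspondence of variables that is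
given by the list `ρ` of pairs of binders. -/
structure MapsMatch (ρ : List (Name × Name)) (V W : Name → Term) : Prop where
  left : ∀ x ∈ support V, ∃ y, AlphaVar ρ x y ∧ V x = W y
  right : ∀ y ∈ support W, ∃ x, AlphaVar ρ x y ∧ V x = W y

namespace MapsMatch

variable {ρ : List (Name × Name)} {V W V' W' : Name → Term} {x y : Name}

theorem apply_eq (h : MapsMatch ρ V W) (hxy : AlphaVar ρ x y) : V x = W y := by
  by_cases hx : V x = .nil
  · by_contra hne
    obtain ⟨x', hx'y, hx'⟩ := h.right y fun hy => hne (hx.trans hy.symm)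
    exact hne ((hxy.eq_iff hx'y).2 rfl ▸ hx')
  · obtain ⟨y', hxy', hy'⟩ := h.left x hx
    exact (hxy.eq_iff hxy').1 rfl ▸ hy'

theorem ncard_support_eq (h : MapsMatch ρ V W) : (support V).ncard = (support W).ncard := by
  choose! φ hφ hVφ using h.left
  refine Set.ncard_congr (fun x _ => φ x) (fun x hx => (hVφ x hx).symm.trans_ne hx)
    (fun x x' hx hx' e => ((hφ x hx).eq_iff (hφ x' hx')).2 e) fun y hy => ?_
  obtain ⟨x, hxy, hx⟩ := h.right y hy
  have hx' : x ∈ support V := hx.trans_ne hy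
  exact ⟨x, hx', ((hφ x hx').eq_iff hxy).1 rfl⟩

theorem moreEntries_eq (h : MapsMatch ρ V W) (h' : MapsMatch ρ V' W') :
    moreEntries V V' = moreEntries W W' := by
  rw [moreEntries, moreEntries, h.ncard_support_eq, h'.ncard_support_eq]

end MapsMatch

variable {ρ : List (Name × Name)} {V W V' W' : Name → Term} {x y : Name}

theorem mapsMatch_var :
    MapsMatch ρ (var x).positions (var y).positions ↔ AlphaVar ρ x y := by
  have support_var (z : Name) : support (var z).positions = {z} := by
    ext z'
    by_cases h : z' = z <;> simp [support, positions, h]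
  refine ⟨fun h => ?_, fun hxy => ⟨?_, ?_⟩⟩
  · obtain ⟨z, hxz, hz⟩ := h.left x (by rw [support_var]; rfl)
    have hzy : z ∈ support (var y).positions := hz.symm.trans_ne (by simp [positions])
    rw [support_var] at hzy
    exact hzy ▸ hxz
  · rw [support_var]
    rintro _ rfl
    exact ⟨y, hxy, by simp [positions]⟩
  · rw [support_var]
    rintro _ rfl
    exact ⟨x, hxy, by simp [positions]⟩

theorem mapsMatch_cons :
    MapsMatch ((x, y) :: ρ) V W ↔
      V x = W y ∧ MapsMatch ρ (Function.update V x .nil) (Function.update W y .nil) := by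
  constructor
  · intro h
    refine ⟨h.apply_eq (.inl ⟨rfl, rfl⟩), ⟨fun u hu => ?_, fun v hv => ?_⟩⟩
    · have := h.left u
      grind [support, AlphaVar]
    · have := h.right v
      grind [support, AlphaVar]
  · rintro ⟨hxy, h⟩
    refine ⟨fun u hu => ?_, fun v hv => ?_⟩
    · have := h.left u
      grind [support, AlphaVar]
    · have := h.right v
      grind [support, AlphaVar]

theorem mapsMatch_combine {M t : ℕ} (hMt : M < t) (hV : ∀ x, WellFormed M (V x))
    (hW : ∀ y, WellFormed M (W y)) :
    MapsMatch ρ (fun x => combine t (V x) (V' x)) (fun y => combine t (W y) (W' y)) ↔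
      MapsMatch ρ V W ∧ MapsMatch ρ V' W' := by
  have inj (x y : Name) := combine_inj hMt (hV x) (hW y) (q := V' x) (q' := W' y)
  constructor
  · intro h
    have left {x : Name} (hx : V x ≠ .nil ∨ V' x ≠ .nil) :
        ∃ y, AlphaVar ρ x y ∧ V x = W y ∧ V' x = W' y := by
      simpa only [inj] using h.left x (combine_ne_nil_iff.2 hx)
    have right {y : Name} (hy : W y ≠ .nil ∨ W' y ≠ .nil) :
        ∃ x, AlphaVar ρ x y ∧ V x = W y ∧ V' x = W' y := by
      simpa only [inj] using h.right y (combine_ne_nil_iff.2 hy)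
    exact ⟨⟨fun x hx => (left (.inl hx)).imp fun y h => ⟨h.1, h.2.1⟩,
        fun y hy => (right (.inl hy)).imp fun x h => ⟨h.1, h.2.1⟩⟩,
      ⟨fun x hx => (left (.inr hx)).imp fun y h => ⟨h.1, h.2.2⟩,
        fun y hy => (right (.inr hy)).imp fun x h => ⟨h.1, h.2.2⟩⟩⟩
  · rintro ⟨h, h'⟩
    have eq {x y : Name} (hxy : AlphaVar ρ x y) :
        combine t (V x) (V' x) = combine t (W y) (W' y) := by
      rw [h.apply_eq hxy, h'.apply_eq hxy]
    refine ⟨fun x hx => ?_, fun y hy => ?_⟩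
    · rcases combine_ne_nil_iff.1 hx with hx | hx
      · exact (h.left x hx).imp fun y hy => ⟨hy.1, eq hy.1⟩
      · exact (h'.left x hx).imp fun y hy => ⟨hy.1, eq hy.1⟩
    · rcases combine_ne_nil_iff.1 hy with hy | hy
      · exact (h.right y hy).imp fun x hx => ⟨hx.1, eq hx.1⟩
      · exact (h'.right y hy).imp fun x hx => ⟨hx.1, eq hx.1⟩

theorem mapsMatch_mergeMaps {M t : ℕ} (hMt : M < t) (hV : ∀ x, WellFormed M (V x))
    (hW : ∀ y, WellFormed M (W y)) (hV' : ∀ x, WellFormed M (V' x))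
    (hW' : ∀ y, WellFormed M (W' y)) (hmore : moreEntries V V' = moreEntries W W') :
    MapsMatch ρ (mergeMaps t V V') (mergeMaps t W W') ↔
      MapsMatch ρ V W ∧ MapsMatch ρ V' W' := by
  unfold mergeMaps
  rw [hmore]
  split_ifs
  · exact mapsMatch_combine hMt hV hW
  · exact (mapsMatch_combine hMt hV' hW').trans and_comm

theorem mapsMatch_nil : MapsMatch [] V W ↔ V = W := by
  refine ⟨fun h => funext fun x => h.apply_eq rfl, ?_⟩
  rintro rfl
  exact ⟨fun x _ => ⟨x, rfl, rfl⟩, fun x _ => ⟨x, rfl, rfl⟩⟩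

namespace Expression

theorem shape_app_eq_iff {a₁ a₂ c₁ c₂ : Expression} :
    (app a₁ a₂).shape = (app c₁ c₂).shape ↔
      moreEntries a₁.positions a₂.positions = moreEntries c₁.positions c₂.positions ∧
        a₁.shape = c₁.shape ∧ a₂.shape = c₂.shape := by
  simp only [shape, BinaryTree.node.injEq, Label.app.injEq]
  refine ⟨fun h => ⟨h.1.2, h.2⟩, fun h => ⟨⟨?_, h.1⟩, h.2⟩⟩
  rw [size_eq_of_shape_eq h.2.1, size_eq_of_shape_eq h.2.2]

theorem mapsMatch_app {a₁ a₂ c₁ c₂ : Expression} (h₁ : a₁.shape = c₁.shape)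
    (h₂ : a₂.shape = c₂.shape)
    (hmore : moreEntries a₁.positions a₂.positions = moreEntries c₁.positions c₂.positions) :
    MapsMatch ρ (app a₁ a₂).positions (app c₁ c₂).positions ↔
      MapsMatch ρ a₁.positions c₁.positions ∧ MapsMatch ρ a₂.positions c₂.positions := by
  have hsize₁ := size_eq_of_shape_eq h₁
  have hsize₂ := size_eq_of_shape_eq h₂
  rw [positions, positions, ← hsize₁, ← hsize₂]
  have wellFormed {a : Expression} (ha : a.size ≤ a₁.size + a₂.size) (z : Name) :=
    (isPosition_positions ha z).wellFormed
  exact mapsMatch_mergeMaps (Nat.lt_succ_self _) (wellFormed (by lia)) (wellFormed (by lia))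
    (wellFormed (by lia)) (wellFormed (by lia)) hmore

theorem alphaEqIn_iff {a c : Expression} :
    AlphaEqIn ρ a c ↔ a.shape = c.shape ∧ MapsMatch ρ a.positions c.positions := by
  induction a generalizing c ρ with
  | var x =>
    cases c with
    | var y => simp only [AlphaEqIn, shape, true_and, mapsMatch_var]
    | _ => simp [AlphaEqIn, shape]
  | lam x a ih =>
    cases c with
    | lam y c =>
      rw [AlphaEqIn, ih, mapsMatch_cons, shape, shape, positions, positions]
      simp only [BinaryTree.node.injEq, Label.lam.injEq, Nat.add_right_cancel_iff]
      have := size_eq_of_shape_eq (a := a) (c := c)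
      tauto
    | _ => simp [AlphaEqIn, shape]
  | app a₁ a₂ ih₁ ih₂ =>
    cases c with
    | app c₁ c₂ =>
      rw [AlphaEqIn, ih₁, ih₂, shape_app_eq_iff]
      constructor
      · rintro ⟨⟨hs₁, hm₁⟩, hs₂, hm₂⟩
        have hmore := hm₁.moreEntries_eq hm₂
        exact ⟨⟨hmore, hs₁, hs₂⟩, (mapsMatch_app hs₁ hs₂ hmore).2 ⟨hm₁, hm₂⟩⟩
      · rintro ⟨⟨hmore, hs₁, hs₂⟩, hm⟩
        obtain ⟨hm₁, hm₂⟩ := (mapsMatch_app hs₁ hs₂ hmore).1 hm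
        exact ⟨⟨hs₁, hm₁⟩, hs₂, hm₂⟩
    | _ => simp [AlphaEqIn, shape]

theorem alphaEq_iff {a c : Expression} :
    a.AlphaEq c ↔ a.shape = c.shape ∧ a.positions = c.positions := by
  rw [AlphaEq, alphaEqIn_iff, mapsMatch_nil]

end Expression

end AlphaEquivalence

section Algorithm

variable {b : ℕ} (f : HashFun b)

/-- The contribution to the hash code of a variable map of the variable `x`, when `t` is its
position tree; a missing entry contributes nothing. -/
def entryCode (x : Name) (t : Term) : HashCode b :=
  (hashTree f t).elim 0 fun h => f (.entry (f (.name x)) h)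

/-- The hash code of a variable map with support in `N`. -/
def mapHash (N : Finset Name) (V : Name → Term) : HashCode b :=
  N.fold (· ^^^ ·) 0 fun x => entryCode f x (V x)

/-- The call to the top-level combiner for an expression with free variables in `N`. -/
noncomputable def summaryCall (N : Finset Name) (e : Expression) : HashCall b :=
  .summary ((hashTree f e.shape).getD 0) (mapHash f N e.positions)

/-- The representation of a position tree in the algorithm. -/
def evalPosition (t : Term) : Option (PosTree b) :=
  (hashTree f t).map fun h => ⟨h, t.numNodes⟩

variable {f}

theorem mapHash_eq_xor_erase {N : Finset Name} {x : Name} (hx : x ∈ N) (V : Name → Term) :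
    mapHash f N V = entryCode f x (V x) ^^^ mapHash f (N.erase x) V := by
  rw [mapHash, ← Finset.insert_erase hx, Finset.fold_insert (Finset.notMem_erase x N),
    Finset.erase_insert (Finset.notMem_erase x N)]
  rfl

theorem mapHash_congr {f g : HashFun b} {N : Finset Name} {V W : Name → Term}
    (h : ∀ y ∈ N, entryCode f y (V y) = entryCode g y (W y)) : mapHash f N V = mapHash g N W :=
  Finset.fold_congr h

theorem mapHash_update {N : Finset Name} {x : Name} (hx : x ∈ N) (V : Name → Term) (t : Term) :
    mapHash f N (Function.update V x t) =
      mapHash f N V ^^^ entryCode f x (V x) ^^^ entryCode f x t := by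
  have herase : mapHash f (N.erase x) (Function.update V x t) = mapHash f (N.erase x) V :=
    mapHash_congr fun y hy => by rw [Function.update_of_ne (Finset.ne_of_mem_erase hy)]
  rw [mapHash_eq_xor_erase hx, mapHash_eq_xor_erase hx V, herase, Function.update_self,
    BitVec.xor_comm (entryCode f x (V x)), BitVec.xor_assoc (mapHash f _ V), BitVec.xor_self,
    BitVec.xor_zero, BitVec.xor_comm]

theorem evalPosition_eq_none {t : Term} : evalPosition f t = none ↔ t = .nil := by
  rw [evalPosition, Option.map_eq_none_iff, hashTree_eq_none]

theorem map_hash_evalPosition (t : Term) : (evalPosition f t).map PosTree.hash = hashTree f t := by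
  cases t <;> rfl

theorem elim_size_evalPosition (t : Term) :
    (evalPosition f t).elim 0 PosTree.size = t.numNodes := by
  cases t <;> rfl

theorem elim_entryHash_evalPosition (x : Name) (t : Term) :
    (evalPosition f t).elim 0 (entryHash f x) = entryCode f x t := by
  cases t <;> rfl

theorem evalPosition_combine (t : ℕ) (big : Term) {small : Term} {p : PosTree b}
    (hp : evalPosition f small = some p) :
    evalPosition f (combine t big small) = some (mkPTJoin f t (evalPosition f big) p) := by
  cases small with
  | nil => simp [evalPosition, hashTree] at hp
  | node ℓ l r =>
    obtain rfl := Option.some_inj.1 hp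
    rw [mkPTJoin, map_hash_evalPosition, elim_size_evalPosition]
    rfl

theorem alterVM_entries (g : Option (PosTree b) → PosTree b) (x : Name) (vm : VarMap b) :
    (alterVM f g x vm).entries = vm.entries.insert x (g (vm.entries.lookup x)) := by
  unfold alterVM
  split <;> simp_all

theorem alterVM_hash (g : Option (PosTree b) → PosTree b) (x : Name) (vm : VarMap b) :
    (alterVM f g x vm).hash = vm.hash ^^^ (vm.entries.lookup x).elim 0 (entryHash f x) ^^^
      entryHash f x (g (vm.entries.lookup x)) := by
  unfold alterVM
  split <;> simp_all

/-- The map `vm` that the algorithm maintains contains the position trees `V`, and its hash code is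
up to date. The set `N` has to contain the support of `V`. -/
structure VarMap.Represents (vm : VarMap b) (f : HashFun b) (N : Finset Name) (V : Name → Term) :
    Prop where
  lookup : ∀ y, vm.entries.lookup y = evalPosition f (V y)
  hash : vm.hash = mapHash f N V

namespace VarMap.Represents

variable {vm vm' : VarMap b} {N : Finset Name} {V W : Name → Term} {x : Name}

theorem sizeVM_eq (h : vm.Represents f N V) : sizeVM vm = (support V).ncard := by
  have hsupport : support V = vm.entries.keys.toFinset := by
    ext y
    rw [Finset.mem_coe, List.mem_toFinset, ← AList.mem_keys, ← AList.lookup_isSome, h.lookup,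
      Option.isSome_iff_ne_none, ne_eq, evalPosition_eq_none]
    rfl
  rw [hsupport, Set.ncard_coe_finset, List.toFinset_card_of_nodup vm.entries.keys_nodup, AList.keys,
    List.keys, List.length_map, sizeVM]

theorem singleton (hx : x ∈ N) :
    (singletonVM f x (mkPTHere f)).Represents f N (Expression.var x).positions where
  lookup y := by
    by_cases h : y = x
    · rw [h, Expression.positions, Function.update_self]
      exact List.dlookup_cons_eq _ _ _
    · simp [singletonVM, Expression.positions, AList.lookup, AList.singleton, h,
        evalPosition, hashTree]
  hash := by
    have hempty : mapHash f N (fun _ => .nil) = 0 := by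
      simp [mapHash, entryCode, hashTree, Finset.fold_const]
    rw [Expression.positions, mapHash_update hx, hempty]
    simp [singletonVM, entryCode, hashTree, entryHash, mkPTHere, Label.call]

theorem alter (h : vm.Represents f N V) (hx : x ∈ N) {g : Option (PosTree b) → PosTree b} {t : Term}
    (hg : evalPosition f t = some (g (evalPosition f (V x)))) :
    (alterVM f g x vm).Represents f N (Function.update V x t) where
  lookup y := by
    rw [alterVM_entries, h.lookup]
    obtain rfl | hy := eq_or_ne y x
    · rw [AList.lookup_insert, Function.update_self, hg]
    · rw [AList.lookup_insert_ne hy, Function.update_of_ne hy, h.lookup]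
  hash := by
    rw [alterVM_hash, h.lookup, h.hash, mapHash_update hx, elim_entryHash_evalPosition,
      ← elim_entryHash_evalPosition x t, hg, Option.elim_some]

theorem remove_snd (h : vm.Represents f N V) (x : Name) :
    (removeFromVM f x vm).2 = evalPosition f (V x) := by
  rw [← h.lookup]
  unfold removeFromVM
  split <;> simp_all

theorem remove_fst (h : vm.Represents f N V) (hx : V x ≠ .nil → x ∈ N) :
    (removeFromVM f x vm).1.Represents f N (Function.update V x .nil) := by
  by_cases hVx : V x = .nil
  · have hlookup : vm.entries.lookup x = none := by rw [h.lookup, evalPosition_eq_none, hVx]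
    rw [← hVx, Function.update_eq_self, removeFromVM, hlookup]
    exact h
  · obtain ⟨p, hp⟩ := Option.ne_none_iff_exists'.1 (evalPosition_eq_none (f := f).not.2 hVx)
    have hlookup : vm.entries.lookup x = some p := by rw [h.lookup, hp]
    rw [removeFromVM, hlookup]
    refine ⟨fun y => ?_, ?_⟩
    · obtain rfl | hy := eq_or_ne y x
      · rw [AList.lookup_erase, Function.update_self]
        rfl
      · rw [AList.lookup_erase_ne hy, Function.update_of_ne hy, h.lookup]
    · rw [mapHash_update (hx hVx), ← elim_entryHash_evalPosition x (V x), hp, h.hash]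
      exact BitVec.xor_zero.symm

theorem foldr (h : vm.Represents f N V) (t : ℕ) {l : List (Sigma fun _ : Name => PosTree b)}
    (hl : l.NodupKeys) (hW : ∀ y, l.dlookup y = evalPosition f (W y)) (hN : support W ⊆ N) :
    (l.foldr (fun kv vm => alterVM f (fun mp => mkPTJoin f t mp kv.2) kv.1 vm) vm).Represents f N
      fun y => combine t (V y) (W y) := by
  induction l generalizing W with
  | nil =>
    have hW' (y : Name) : W y = .nil := evalPosition_eq_none.1 (hW y).symm
    simpa only [hW', combine, List.foldr_nil] using h
  | cons kv l ih =>
    obtain ⟨k, p⟩ := kv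
    obtain ⟨hk, hl⟩ := List.nodupKeys_cons.1 hl
    have hWk : evalPosition f (W k) = some p := by rw [← hW, List.dlookup_cons_eq]
    have hkN : k ∈ N := hN fun hnil => by simp [hnil, evalPosition, hashTree] at hWk
    have ih' := ih (W := Function.update W k .nil) hl (fun y => ?_) fun y hy => ?_
    · have hmap : (fun y => combine t (V y) (W y)) = Function.update
          (fun y => combine t (V y) (Function.update W k .nil y)) k (combine t (V k) (W k)) := by
        funext y
        by_cases hy : y = k <;> simp [hy]
      rw [List.foldr_cons, hmap]
      refine ih'.alter hkN ?_
      simpa only [Function.update_self, combine] using evalPosition_combine t (V k) hWk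
    · obtain rfl | hy := eq_or_ne y k
      · rw [Function.update_self, List.dlookup_eq_none.2 hk]
        rfl
      · rw [Function.update_of_ne hy, ← hW, List.dlookup_cons_ne _ _ hy]
    · obtain rfl | hyk := eq_or_ne y k
      · exact hkN
      · exact hN ((Function.update_of_ne hyk _ _).symm.trans_ne hy)

theorem merge (h : vm.Represents f N V) (h' : vm'.Represents f N W) (hV : support V ⊆ N)
    (hW : support W ⊆ N) (t : ℕ) :
    ((if moreEntries V W then vm' else vm).entries.entries.foldr
      (fun kv vm => alterVM f (fun mp => mkPTJoin f t mp kv.2) kv.1 vm)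
      (if moreEntries V W then vm else vm')).Represents f N (mergeMaps t V W) := by
  unfold mergeMaps
  split_ifs
  · exact h.foldr t vm'.entries.nodupKeys h'.lookup hW
  · exact h'.foldr t vm.entries.nodupKeys h.lookup hV

end VarMap.Represents

theorem represents_summariseExpr (f : HashFun b) {e : Expression} {N : Finset Name}
    (hN : e.vars ⊆ N) :
    hashTree f e.shape = some (summariseExpr f e).str.hash ∧
      (summariseExpr f e).str.size = e.size ∧
        (summariseExpr f e).vm.Represents f N e.positions := by
  induction e with
  | var x => exact ⟨rfl, rfl, .singleton (hN (Finset.mem_singleton_self x))⟩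
  | lam x a ih =>
    obtain ⟨hhash, hsize, hvm⟩ := ih hN
    refine ⟨?_, congrArg (· + 1) hsize, hvm.remove_fst fun hx => hN (a.support_positions_subset hx)⟩
    simp only [summariseExpr, mkSLam, Expression.shape, hashTree, Label.call, hhash, hsize,
      hvm.remove_snd, map_hash_evalPosition, Option.getD_some]
  | app a c iha ihc =>
    obtain ⟨ha, hc⟩ := Finset.union_subset_iff.1 hN
    obtain ⟨hhash, hsize, hvm⟩ := iha ha
    obtain ⟨hhash', hsize', hvm'⟩ := ihc hc
    have hmore : decide (sizeVM (summariseExpr f c).vm < sizeVM (summariseExpr f a).vm) =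
        moreEntries a.positions c.positions := by
      rw [hvm.sizeVM_eq, hvm'.sizeVM_eq, moreEntries]
    have hVW := hvm.merge hvm' (a.support_positions_subset.trans ha)
      (c.support_positions_subset.trans hc) (a.size + c.size + 1)
    simp only [summariseExpr, hmore, structureTag, mkSApp, hsize, hsize']
    refine ⟨?_, rfl, hVW⟩
    simp only [Expression.shape, hashTree, Label.call, hhash, hhash', Option.getD_some]

theorem hashESummary_summariseExpr (f : HashFun b) {e : Expression} {N : Finset Name}
    (hN : e.vars ⊆ N) :
    hashESummary f (summariseExpr f e) = f (summaryCall f N e) := by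
  obtain ⟨hhash, -, hvm⟩ := represents_summariseExpr f hN
  rw [hashESummary, summaryCall, hhash, hvm.hash, Option.getD_some]

theorem hashESummary_eq_of_alphaEq (f : HashFun b) {a c : Expression} (h : a.AlphaEq c) :
    hashESummary f (summariseExpr f a) = hashESummary f (summariseExpr f c) := by
  obtain ⟨hshape, hpositions⟩ := Expression.alphaEq_iff.1 h
  rw [hashESummary_summariseExpr f (N := a.vars ∪ c.vars) Finset.subset_union_left,
    hashESummary_summariseExpr f (N := a.vars ∪ c.vars) Finset.subset_union_right, summaryCall,
    summaryCall, hshape, hpositions]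

theorem recoveredClasses_eq {f : HashFun b} {e : Expression}
    (h : ∀ i j, hashESummary f (summariseExpr f (e.at_ i)) =
      hashESummary f (summariseExpr f (e.at_ j)) → (e.at_ i).AlphaEq (e.at_ j)) :
    recoveredClasses f e = alphaClasses e := by
  unfold recoveredClasses alphaClasses
  congr! 4 with i j
  exact ⟨h i j, hashESummary_eq_of_alphaEq f⟩

end Algorithm

section Bounds

variable {b : ℕ} {P : Measure (HashFun b)}

theorem finitelyDetermined_nameCode (x : Name) :
    FinitelyDetermined fun f : HashFun b => f (.name x) :=
  (FinitelyDetermined.const (HashCall.name x)).apply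

theorem finitelyDetermined_entryCode (x : Name) (t : Term) :
    FinitelyDetermined fun f : HashFun b => entryCode f x t := by
  cases t with
  | nil => exact .const 0
  | node ℓ l r =>
    exact ((finitelyDetermined_nameCode x).comp₂ HashCall.entry
      (finitelyDetermined_rootCall ℓ l r).apply).apply

theorem finitelyDetermined_mapHash (N : Finset Name) (V : Name → Term) :
    FinitelyDetermined fun f : HashFun b => mapHash f N V :=
  .of_forall_mem N (fun x => finitelyDetermined_entryCode x (V x)) fun _ _ => mapHash_congr

theorem hashTree_eq_of_eqOn_compl {f f' : HashFun b} {c : HashCall b}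
    (h : Set.EqOn f' f {c}ᶜ) (hc : ∀ (ℓ : Label) p q, ℓ.call p q ≠ c) (t : Term) :
    hashTree f' t = hashTree f t :=
  hashTree_congr fun ℓ _ p q => h (hc ℓ p q)

theorem entryCode_eq_of_eqOn_compl_summary {f f' : HashFun b} {s m : HashCode b}
    (h : Set.EqOn f' f {.summary s m}ᶜ) (x : Name) (t : Term) :
    entryCode f' x t = entryCode f x t := by
  rw [entryCode, entryCode, hashTree_eq_of_eqOn_compl h (by rintro (_ | _) <;> simp [Label.call]),
    h (x := .name x) (by simp)]
  cases hashTree f t with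
  | none => rfl
  | some p => exact h (x := .entry _ p) (by simp)

theorem entryCode_eq_of_eqOn_compl_entry {f f' : HashFun b} {n h : HashCode b}
    (hff' : Set.EqOn f' f {.entry n h}ᶜ) {x : Name} {t : Term}
    (hne : f (.name x) = n → hashTree f t ≠ some h) : entryCode f' x t = entryCode f x t := by
  rw [entryCode, entryCode,
    hashTree_eq_of_eqOn_compl hff' (by rintro (_ | _) <;> simp [Label.call]),
    hff' (x := .name x) (by simp)]
  cases ht : hashTree f t with
  | none => rfl
  | some p => exact hff' fun he => by grind

theorem measureReal_name_collision_le (hP : IsRandomFunction P) {x y : Name} (hxy : x ≠ y) :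
    P.real {f | f (.name x) = f (.name y)} ≤ 1 / 2 ^ b := by
  have h := hP.measureReal_collision_le (.const (HashCall.name x)) (.const (.name y))
    fun _ _ _ => ⟨rfl, rfl⟩
  simpa only [ne_eq, HashCall.name.injEq, hxy, not_false_eq_true, true_and,
    inv_card_hashCode] using h

theorem entryCode_of_ne_nil (f : HashFun b) (x : Name) {t : Term} (ht : t ≠ .nil) :
    entryCode f x t = f (.entry (f (.name x)) ((hashTree f t).getD 0)) := by
  cases t with
  | nil => contradiction
  | node ℓ l r => rfl

/-- Once the name of `x` is hashed differently from all other names, the call for the entry of `x`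
in `V` is made nowhere else, so it can be resampled. -/
theorem measureReal_mapHash_eq_of_fresh_le (hP : IsRandomFunction P) {N : Finset Name}
    {V W : Name → Term} {x : Name} (hx : x ∈ N) (hVx : V x ≠ .nil) :
    P.real {f | (∀ y ∈ N.erase x, f (.name y) ≠ f (.name x)) ∧
      hashTree f (V x) ≠ hashTree f (W x) ∧ mapHash f N V = mapHash f N W} ≤ 1 / 2 ^ b := by
  refine (hP.measureReal_le_of_resample
    (a := fun f => .entry (f (.name x)) ((hashTree f (V x)).getD 0))
    (g := fun f => mapHash f N W ^^^ mapHash f (N.erase x) V) ?_ ?_ ?_ ?_).trans_eq ?_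
  · have hfresh : FinitelyDetermined fun f : HashFun b =>
        ∀ y ∈ N.erase x, f (.name y) ≠ f (.name x) :=
      .of_forall_mem (N.erase x)
        (fun y => (finitelyDetermined_nameCode y).comp₂ (· ≠ ·) (finitelyDetermined_nameCode x))
        fun f f' h => propext (forall₂_congr fun y hy => (h y hy).to_iff)
    exact hfresh.comp₂ And
      (((finitelyDetermined_hashTree _).comp₂ (· ≠ ·) (finitelyDetermined_hashTree _)).comp₂ And
        ((finitelyDetermined_mapHash N V).comp₂ (· = ·) (finitelyDetermined_mapHash N W)))
  · exact (finitelyDetermined_nameCode x).comp₂ (fun n h => HashCall.entry n (h.getD 0))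
      (finitelyDetermined_hashTree (V x))
  · rintro f ⟨-, -, hmap⟩
    rw [← hmap, mapHash_eq_xor_erase hx, BitVec.xor_assoc, BitVec.xor_self, BitVec.xor_zero,
      entryCode_of_ne_nil f x hVx]
  · rintro f ⟨hfresh, hhash, -⟩ f' hff'
    obtain ⟨h, hh⟩ := Option.ne_none_iff_exists'.1 ((hashTree_eq_none (f := f)).not.2 hVx)
    rw [hh] at hhash
    simp only [hh, Option.getD_some] at hff'
    have hV : hashTree f' (V x) = hashTree f (V x) :=
      hashTree_eq_of_eqOn_compl hff' (by rintro (_ | _) <;> simp [Label.call]) _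
    have hname : f' (.name x) = f (.name x) := hff' (by simp)
    have hmapV : mapHash f' (N.erase x) V = mapHash f (N.erase x) V :=
      mapHash_congr fun y hy => entryCode_eq_of_eqOn_compl_entry hff' fun h => (hfresh y hy h).elim
    have hmapW : mapHash f' N W = mapHash f N W := by
      refine mapHash_congr fun y hy => entryCode_eq_of_eqOn_compl_entry hff' fun hyx => ?_
      obtain rfl : y = x := by_contra fun hne => hfresh y (Finset.mem_erase.2 ⟨hne, hy⟩) hyx
      exact hhash.symm
    exact ⟨by rw [hV, hname], by rw [hmapV, hmapW]⟩
  · exact inv_card_hashCode b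

theorem measureReal_mapHash_eq_le (hP : IsRandomFunction P) {M : ℕ} (hM : M < 2 ^ b)
    {N : Finset Name} {V W : Name → Term} {x : Name} (hx : x ∈ N) (hV : WellFormed M (V x))
    (hW : WellFormed M (W x)) (hVW : V x ≠ W x) {k : ℕ} (hVk : (V x).height ≤ k)
    (hWk : (W x).height ≤ k) :
    P.real {f | mapHash f N V = mapHash f N W} ≤ (N.card + k) / 2 ^ b := by
  wlog hVx : V x ≠ .nil generalizing V W
  · have hWx : W x ≠ .nil := fun h => hVW ((not_not.1 hVx).trans h.symm)
    simpa only [eq_comm] using this hW hV hVW.symm hWk hVk hWx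
  have := hP.2.isProbabilityMeasure
  have hnames : P.real (⋃ y ∈ N.erase x, {f | f (.name y) = f (.name x)}) ≤
      (N.erase x).card / 2 ^ b := by
    refine (measureReal_biUnion_finset_le _ _).trans ((Finset.sum_le_card_nsmul _ _ _ fun y hy =>
      measureReal_name_collision_le hP (Finset.ne_of_mem_erase hy)).trans_eq ?_)
    rw [nsmul_eq_mul, mul_one_div]
  have htrees : P.real {f | hashTree f (V x) = hashTree f (W x)} ≤ k / 2 ^ b :=
    (measureReal_hashTree_eq_le hP hM hV hW hVW).trans (by gcongr)
  have hfresh := measureReal_mapHash_eq_of_fresh_le (W := W) hP hx hVx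
  calc P.real {f | mapHash f N V = mapHash f N W}
    _ ≤ P.real ((⋃ y ∈ N.erase x, {f | f (.name y) = f (.name x)}) ∪
          ({f | hashTree f (V x) = hashTree f (W x)} ∪
            {f | (∀ y ∈ N.erase x, f (.name y) ≠ f (.name x)) ∧
              hashTree f (V x) ≠ hashTree f (W x) ∧ mapHash f N V = mapHash f N W})) := by
      refine measureReal_mono fun f hf => ?_
      simp only [Set.mem_union, Set.mem_iUnion, Set.mem_ofPred_eq] at hf ⊢
      grind
    _ ≤ (N.erase x).card / 2 ^ b + (k / 2 ^ b + 1 / 2 ^ b) := by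
      grw [measureReal_union_le, measureReal_union_le, hnames, htrees, hfresh]
    _ = (N.card + k) / 2 ^ b := by
      rw [← Finset.card_erase_add_one hx]
      push_cast
      ring

theorem finitelyDetermined_summaryCall (N : Finset Name) (e : Expression) :
    FinitelyDetermined fun f : HashFun b => summaryCall f N e :=
  (finitelyDetermined_hashTree e.shape).comp₂ (fun s m => HashCall.summary (s.getD 0) m)
    (finitelyDetermined_mapHash N e.positions)

theorem measureReal_summaryCall_collision_le (hP : IsRandomFunction P) (N : Finset Name)
    (a c : Expression) :
    P.real {f | summaryCall f N a ≠ summaryCall f N c ∧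
      f (summaryCall f N a) = f (summaryCall f N c)} ≤ 1 / 2 ^ b := by
  refine (hP.measureReal_collision_le (finitelyDetermined_summaryCall N a)
    (finitelyDetermined_summaryCall N c) fun f f' h => ?_).trans_eq ?_
  · have hcall (e : Expression) : summaryCall f' N e = summaryCall f N e := by
      rw [summaryCall, summaryCall,
        hashTree_eq_of_eqOn_compl h (by rintro (_ | _) <;> simp [Label.call, summaryCall]),
        mapHash_congr fun y _ => entryCode_eq_of_eqOn_compl_summary h y _]
    exact ⟨hcall a, hcall c⟩
  · exact inv_card_hashCode b

theorem measureReal_summaryCall_eq_le (hP : IsRandomFunction P) {n : ℕ} (hn : n < 2 ^ b)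
    {N : Finset Name} {a c : Expression} (ha : a.size ≤ n) (hc : c.size ≤ n) (haN : a.vars ⊆ N)
    (hcN : c.vars ⊆ N) (hac : ¬ a.AlphaEq c) :
    P.real {f | summaryCall f N a = summaryCall f N c} ≤ (N.card + n) / 2 ^ b := by
  have := hP.2.isProbabilityMeasure
  have inj {f : HashFun b} (h : summaryCall f N a = summaryCall f N c) :=
    (HashCall.summary.injEq ..).mp h
  by_cases hshape : a.shape = c.shape
  · obtain ⟨x, hx⟩ : ∃ x, a.positions x ≠ c.positions x :=
      Function.ne_iff.1 fun h => hac (Expression.alphaEq_iff.2 ⟨hshape, h⟩)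
    have hxN : x ∈ N := by
      by_cases hax : a.positions x = .nil
      · exact hcN (c.support_positions_subset fun hcx => hx (hax.trans hcx.symm))
      · exact haN (a.support_positions_subset hax)
    have height_le {e : Expression} (he : e.size ≤ n) : (e.positions x).height ≤ n :=
      (BinaryTree.height_le_numNodes _).trans ((e.numNodes_positions_le x).trans he)
    exact (measureReal_mono fun f hf => (inj hf).2).trans (measureReal_mapHash_eq_le hP hn hxN
      (Expression.isPosition_positions ha x).wellFormed
      (Expression.isPosition_positions hc x).wellFormed hx (height_le ha) (height_le hc))
  · calc P.real {f | summaryCall f N a = summaryCall f N c}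
      _ ≤ P.real {f | hashTree f a.shape = hashTree f c.shape} := measureReal_mono fun f hf =>
        hashTree_eq_of_getD_eq a.shape_ne_nil c.shape_ne_nil (inj hf).1
      _ ≤ a.shape.height / 2 ^ b := measureReal_hashTree_eq_le hP hn
        (Expression.wellFormed_shape ha) (Expression.wellFormed_shape hc) hshape
      _ ≤ (N.card + n) / 2 ^ b := by
        gcongr
        exact_mod_cast a.height_shape_le.trans (ha.trans (Nat.le_add_left _ _))

theorem measureReal_hashESummary_eq_le (hP : IsRandomFunction P) {n : ℕ} (hn : n < 2 ^ b)
    {N : Finset Name} {a c : Expression} (ha : a.size ≤ n) (hc : c.size ≤ n) (haN : a.vars ⊆ N)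
    (hcN : c.vars ⊆ N) (hac : ¬ a.AlphaEq c) :
    P.real {f | hashESummary f (summariseExpr f a) = hashESummary f (summariseExpr f c)} ≤
      (N.card + n + 1) / 2 ^ b := by
  have := hP.2.isProbabilityMeasure
  simp only [hashESummary_summariseExpr _ haN, hashESummary_summariseExpr _ hcN]
  calc P.real {f | f (summaryCall f N a) = f (summaryCall f N c)}
    _ ≤ P.real ({f | summaryCall f N a = summaryCall f N c} ∪ {f | summaryCall f N a ≠
        summaryCall f N c ∧ f (summaryCall f N a) = f (summaryCall f N c)}) :=
      measureReal_mono fun f hf => or_iff_not_imp_left.2 fun hne => ⟨hne, hf⟩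
    _ ≤ (N.card + n) / 2 ^ b + 1 / 2 ^ b := by
      grw [measureReal_union_le, measureReal_summaryCall_eq_le hP hn ha hc haN hcN hac,
        measureReal_summaryCall_collision_le hP N a c]
    _ = (N.card + n + 1) / 2 ^ b := (add_div ..).symm

theorem measureReal_recoveredClasses_ne_le (hP : IsRandomFunction P) {e : Expression}
    (he : e.size < 2 ^ b) :
    P.real {f | recoveredClasses f e ≠ alphaClasses e} ≤ 3 * e.size ^ 3 / 2 ^ b := by
  classical
  have := hP.2.isProbabilityMeasure
  let pairs : Finset (e.Node × e.Node) := {p | ¬ (e.at_ p.1).AlphaEq (e.at_ p.2)}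
  let collision (p : e.Node × e.Node) : Set (HashFun b) :=
    {f | hashESummary f (summariseExpr f (e.at_ p.1)) =
      hashESummary f (summariseExpr f (e.at_ p.2))}
  have hpairs : pairs.card ≤ e.size ^ 2 := by
    refine (Finset.card_le_univ _).trans_eq ?_
    rw [Fintype.card_prod, Fintype.card_fin, e.length_subexprs, sq]
  have hcollision : ∀ p ∈ pairs, P.real (collision p) ≤ 3 * e.size / 2 ^ b := by
    intro p hp
    have hsize (i : e.Node) := Expression.size_le_of_mem_subexprs (e.subexprs.get_mem i)
    have hvars (i : e.Node) := Expression.vars_subset_of_mem_subexprs (e.subexprs.get_mem i)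
    refine (measureReal_hashESummary_eq_le hP he (hsize p.1) (hsize p.2) (hvars p.1) (hvars p.2)
      (Finset.mem_filter.1 hp).2).trans ?_
    gcongr
    have hcard := e.card_vars_le
    have hpos := e.size_pos
    exact_mod_cast (by lia : e.vars.card + e.size + 1 ≤ 3 * e.size)
  calc P.real {f | recoveredClasses f e ≠ alphaClasses e}
    _ ≤ P.real (⋃ p ∈ pairs, collision p) := by
      refine measureReal_mono (fun f hf => ?_) (measure_ne_top _ _)
      by_contra hgood
      refine hf (recoveredClasses_eq fun i j hij => by_contra fun hne => hgood ?_)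
      exact Set.mem_biUnion (x := (i, j)) (by simpa [pairs] using hne) hij
    _ ≤ pairs.card • (3 * e.size / 2 ^ b) :=
      (measureReal_biUnion_finset_le _ _).trans (Finset.sum_le_card_nsmul _ _ _ hcollision)
    _ ≤ (e.size ^ 2 : ℕ) • (3 * e.size / 2 ^ b : ℝ) := by gcongr
    _ = 3 * e.size ^ 3 / 2 ^ b := by
      rw [nsmul_eq_mul]
      push_cast
      ring

theorem IsRandomFunction.le_measureReal_recoveredClasses_eq (hP : IsRandomFunction P)
    (e : Expression) :
    1 - 3 * (e.size : ℝ) ^ 3 / 2 ^ b ≤ P.real {f | recoveredClasses f e = alphaClasses e} := by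
  have := hP.2.isProbabilityMeasure
  rw [sub_le_iff_le_add]
  by_cases he : e.size < 2 ^ b
  · calc (1 : ℝ)
      _ = P.real ({f | recoveredClasses f e = alphaClasses e} ∪
          {f | recoveredClasses f e ≠ alphaClasses e}) := by
        rw [← probReal_univ (μ := P)]
        congr 1
        ext f
        simp [em]
      _ ≤ _ := by grw [measureReal_union_le, measureReal_recoveredClasses_ne_le hP he]
  · have hle : (2 : ℝ) ^ b ≤ 3 * (e.size : ℝ) ^ 3 := by
      have := Nat.le_self_pow three_ne_zero e.size
      exact_mod_cast (by lia : 2 ^ b ≤ 3 * e.size ^ 3)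
    exact le_add_of_nonneg_of_le measureReal_nonneg ((one_le_div (by positivity)).2 hle)

end Bounds

end AlphaHash

theorem mainTheorem2 (b : ℕ) (hb : 0 < b) :
    ∃ P : MeasureTheory.Measure (AlphaHash.HashFun b),
      MeasureTheory.IsProbabilityMeasure P ∧ AlphaHash.IsRandomFunction P ∧
      ∀ e : AlphaHash.Expression,
        1 - 5 * (e.size : ℝ) ^ 3 * (2 : ℝ) ^ (-(b : ℤ)) ≤
          P.real {f | AlphaHash.recoveredClasses f e = AlphaHash.alphaClasses e} := by
  obtain ⟨P, hprob, hP⟩ :=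
    AlphaHash.exists_isRandomFunction (AlphaHash.HashCall b) (AlphaHash.HashCode b)
  refine ⟨P, hprob, hP, fun e => le_trans ?_ (hP.le_measureReal_recoveredClasses_eq e)⟩
  rw [zpow_neg, zpow_natCast, ← div_eq_mul_inv]
  gcongr
  norm_num
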